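/- **Conventions.** A chain is a linearly ordered set. For $x\in A$ the tail of $A$ at $x$ is $f_xA=\{y\in A: y\ge x\}$. $A$ is *uniform* if its tails are pairwise order isomorphic, and then $fA$ denotes their common isomorphism type. The $0$-components of $A$ are its points; two points lie in the same $(\alpha+1)$-component iff only finitely many $\alpha$-components meet the interval between them; at limit stages one takes unions. The *rank* of $A$ is the least $\alpha$ such that $A$ is a single $\alpha$-component. $A+B$ is the ordered sum, and $A\cdot I$ is the sum of $I$ copies of $A$. A *string* is a sequence $s=\langle s(0),\dots,s(n)\rangle$ ($n\ge 0$) of natural numbers with $s(i)\le i$. Put $f s=\langle s(0),\dots,s(n-1),0\rangle$ and, for $n\ge1$, $s^-=\langle s(0),\dots,s(n-1)\rangle$ and $s^+=\langle s(0),\dots,s(n-2),s(n)\rangle$; the latter is used only when $s(n)<n$, i.e. when it is a string. The tree of $s$ has root $\langle s;0\rangle$; a node $\langle t;k\rangle$ with $t$ of length at least $2$ has a left extension $\langle t^+;k+1\rangle$ (only if $t^+$ is a string) and a right extension $\langle t^-;0\rangle$; nodes with $t=\langle 0\rangle$ are leaves. Let $\mathrm{lf}(s)$ be the number of leaves and,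 for $i<\mathrm{lf}(s)$, let $\mathrm{wt}^s(i)=k$ if the $i$-th leaf from the left is $\langle\langle0\rangle;k\rangle$. For an array $\mathbf M=[M_0,\dots,M_{\mathrm{lf}(s)-1}]$ of chains put $A(\langle0\rangle)[M_0]=M_0$ and, for $n\ge1$, $$A(s)[\mathbf M]=\begin{cases}A(s^-)[\mathbf M]\cdot\mathbb Z & \text{if } s(n)=n,\\ A(s^+)[M_0,\dots,M_{\mathrm{lf}(s^+)-1}]+A(s^-)[M_{\mathrm{lf}(s^+)},\dots,M_{\mathrm{lf}(s)-1}]\cdot\mathbb N & \text{if } s(n)<n.\end{cases}$$ If $M_0$ is uniform, the *tail array* $f_s(\mathbf M)$ is defined, with ${}^\frown$ denoting concatenation, by $f_{\langle0\rangle}[M_0]=[fM_0]$ and, for $n\ge1$, $$f_s(\mathbf M)=\begin{cases}f_{s^-}(\mathbf M)\,{}^\frown\,\mathbf M & \text{if } s(n)=n,\\ f_{s^+}([M_0,\dots,M_{\mathrm{lf}(s^+)-1}])\,{}^\frown\,[M_{\mathrm{lf}(s^+)},\dots,M_{\mathrm{lf}(s)-1}] & \text{if } s(n)<n.\end{cases}$$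 **Lemma 3.14 (Uniformity over limit lemma, sufficiency part).** Let $s$ be a string and let $\mathbf M=[M_0,\dots,M_{\mathrm{lf}(s)-1}]$ be an array of uniform chains of rank $\omega$ such that (a) $fM_i\cong fM_j$ for all $i,j<\mathrm{lf}(s)$, and (b) $M_i\cong M_j$ whenever $\mathrm{wt}^s(i)=\mathrm{wt}^s(j)$. Then the chain $A(s)[\mathbf M]$ is uniform, and $$f\big(A(s)[\mathbf M]\big)\cong A(f s)\big[f_s(\mathbf M)\big];$$ that is, every tail of $A(s)[\mathbf M]$ is order isomorphic to $A(fs)[f_s(\mathbf M)]$, whichever tail of $M_0$ is chosen to represent $fM_0$. -/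

import Mathlib

universe u v

noncomputable section

namespace UniformChain

/-! ### Chains: uniformity, components, rank -/

/-- A chain is uniform if its tails `{y | x ≤ y}` are pairwise order isomorphic. -/
def Uniform (A : LinOrd.{u}) : Prop :=
  ∀ x y : A, Nonempty (Set.Ici x ≃o Set.Ici y)

/-- `x` and `y` lie in the same `α`-component of the chain `A`.  The `0`-components are the
points; the `(β + 1)`-component of `x` consists of those `y` for which only finitely many
`β`-components meet the interval between `x` and `y` (the elements at finite distance, modulo
`β`-components); at limits one takes unions.  The three clauses are merged into one. -/
def SameComp {A : Type u} [LinearOrder A] (α : Ordinal.{v}) (x y : A) : Prop :=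
  x = y ∨ ∃ β, ∃ _ : β < α, ((fun z => {w | SameComp β z w}) '' Set.uIcc x y).Finite
termination_by α

/-- `A` has rank `α`: `α` is the least ordinal such that `A` is a single `α`-component. -/
def HasRank (A : LinOrd.{u}) (α : Ordinal.{v}) : Prop :=
  IsLeast {β : Ordinal.{v} | ∀ x y : A, SameComp β x y} α

/-- The class `UC(ω)` of uniform chains of rank `ω`. -/
def UCOmega (A : LinOrd.{u}) : Prop :=
  Uniform A ∧ HasRank A Ordinal.omega0.{0}

/-- `f A = f B`: the tails of `A` are order isomorphic to the tails of `B`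
(for uniform chains the choice of the tails does not matter). -/
def SameTail (A B : LinOrd.{u}) : Prop :=
  ∀ (x : A) (y : B), Nonempty (Set.Ici x ≃o Set.Ici y)

/-! ### Index strings: a string `⟨s 0, …, s n⟩` is a function on `Fin (n + 1)` -/

/-- The set `𝕊(n + 1)` of strings `⟨s 0, …, s n⟩` with `s i ≤ i`. -/
def IsString {n : ℕ} (s : Fin (n + 1) → ℕ) : Prop := ∀ i, s i ≤ i

/-- `s⁻ = ⟨s 0, …, s (n - 1)⟩`: delete the last entry. -/
def minus {n : ℕ} (s : Fin (n + 2) → ℕ) : Fin (n + 1) → ℕ := Fin.init s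

/-- `s⁺ = ⟨s 0, …, s (n - 2), s n⟩`: delete the last but one entry.  For a string `s` it is a
string iff `s n < n`; only then is it used. -/
def plus {n : ℕ} (s : Fin (n + 2) → ℕ) : Fin (n + 1) → ℕ :=
  Fin.snoc (α := fun _ => ℕ) (Fin.init (Fin.init s)) (s (Fin.last (n + 1)))

/-- `f s = s⁻ ⌢ ⟨0⟩`: replace the last entry by `0`. -/
def tailString {n : ℕ} (s : Fin (n + 1) → ℕ) : Fin (n + 1) → ℕ :=
  Fin.snoc (α := fun _ => ℕ) (Fin.init s) 0

/-! ### The tree of a string -/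

/-- The leaves, from left to right, of the binary tree that grows from the node `⟨t; k⟩`.
A node `⟨t; k⟩` with `t` of length at least two has the extensions `⟨t⁺; k + 1⟩` (left, only
if `t⁺` is a string) and `⟨t⁻; 0⟩` (right); a node with `t` of length one is a leaf. -/
def leaves : (n : ℕ) → (Fin (n + 1) → ℕ) → ℕ → List ((Fin 1 → ℕ) × ℕ)
  | 0, t, k => [(t, k)]
  | n + 1, t, k =>
      if t (Fin.last (n + 1)) < n + 1 then leaves n (plus t) (k + 1) ++ leaves n (minus t) 0
      else leaves n (minus t) 0

/-- `lf s`: the number of leaves of the tree of `s`, whose root is `⟨s; 0⟩`. -/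
def lf {n : ℕ} (s : Fin (n + 1) → ℕ) : ℕ := (leaves n s 0).length

/-- `wt s i`: the weight of the `i`-th leaf `⟨t; k⟩` of the tree of `s`, that is, `k`. -/
def wt {n : ℕ} (s : Fin (n + 1) → ℕ) (i : Fin (lf s)) : ℕ := ((leaves n s 0).get i).2

/-! ### Arrays of building blocks and the chain constructor

An array `[M 0, …, M (l - 1)]` is a sequence `M : ℕ → LinOrd` of which only the first `l`
entries matter; the length `l` is given by the string it is used with. -/

/-- The chain `A(s)[M 0, …, M (lf s - 1)]`:
`A(⟨0⟩)[M 0] = M 0`;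
`A(s)[M] = A(s⁺)[M 0, …, M (lf s⁺ - 1)] + A(s⁻)[M (lf s⁺), …, M (lf s - 1)] · ℕ` if `s n < n`;
`A(s)[M] = A(s⁻)[M] · ℤ` if `s n = n`.
Here `B · I` is the sum of `I` copies of `B`, the lexicographic product with `I` leading. -/
def chain : (n : ℕ) → (Fin (n + 1) → ℕ) → (ℕ → LinOrd.{u}) → LinOrd.{u}
  | 0, _, M => M 0
  | n + 1, s, M =>
      if s (Fin.last (n + 1)) < n + 1 then
        LinOrd.of (chain n (plus s) M ⊕ₗ
          (ℕ ×ₗ chain n (minus s) (fun i => M (lf (plus s) + i))))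
      else LinOrd.of (ℤ ×ₗ chain n (minus s) M)

/-- Concatenation `[M 0, …, M (l - 1)] ⌢ [N 0, N 1, …]`. -/
def concat (l : ℕ) (M N : ℕ → LinOrd.{u}) : ℕ → LinOrd.{u} :=
  fun i => if i < l then M i else N (i - l)

/-- The tail array `f_s(M)`, an array of length `lf (f s)`:
`f_⟨0⟩[M 0] = [f (M 0)]`;
`f_s(M) = f_{s⁺}(M 0, …, M (lf s⁺ - 1)) ⌢ [M (lf s⁺), …, M (lf s - 1)]` if `s⁺` is a string;
`f_s(M) = f_{s⁻}(M) ⌢ M` otherwise.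
The tail `f (M 0)`, an isomorphism type, is represented by the tail at the point `p`. -/
def tailArray : (n : ℕ) → (Fin (n + 1) → ℕ) → (M : ℕ → LinOrd.{u}) → M 0 → ℕ → LinOrd.{u}
  | 0, _, _, p => fun _ => LinOrd.of (Set.Ici p)
  | n + 1, s, M, p =>
      if s (Fin.last (n + 1)) < n + 1 then
        concat (lf (tailString (plus s))) (tailArray n (plus s) M p)
          (fun i => M (lf (plus s) + i))
      else concat (lf (tailString (minus s))) (tailArray n (minus s) M p) M

end UniformChain

end

/-!
# Uniformity of the chains `A(s)[M]`

The proof is by induction on the length of the string.  A point of `A(s)[M]` lies in a copy of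
`A(s⁻)` or of `A(s⁺)`, its tail is a tail of that copy followed by `ℕ` many copies of `A(s⁻)`, and
`A(fs)` has exactly this shape, because `(fs)⁻ = s⁻` and `(fs)⁺ = f(s⁻) = f(s⁺)`
(`plus_tailString`).  When `s⁺` is a string, points of the two summands must have isomorphic tails,
that is, `A(f(s⁻))` must not depend, up to isomorphism, on whether it is built from the tail array
of the first or of the second part of `M`.  Indeed the two tail arrays are entrywise isomorphic:

* their `0`-th entries are tails of `M 0` and of another entry of `M`, which agree by (a);
* every other entry of a tail array `f_s(M)` is an entry of `M` whose weight in the tree of `s` is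
  the weight of its position in the tree of `fs` (`exists_tailArray_eq`), so (b) applies.

The hypothesis (b) passes from `s` to `s⁺` although the root of the tree of `s⁺` is reached with
weight `1` rather than `0`: the weight of the root only influences the leftmost leaf, and if it
does, then that leaf is the only one whose weight is at least the length of the string minus one
(`leafWt_lt` and `leafWt_eq_of_lt`).
-/

open UniformChain

namespace UniformChain

/-! ### Tails of sums and products of chains -/

section Tails

variable {α β : Type*} [LinearOrder α] [LinearOrder β]

theorem nonempty_Ici_inlₗ_orderIso (x : α) :
    Nonempty (Set.Ici (Sum.inlₗ x : α ⊕ₗ β) ≃o Set.Ici x ⊕ₗ β) := by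
  let f : Set.Ici x ⊕ₗ β → Set.Ici (Sum.inlₗ x : α ⊕ₗ β) := fun z =>
    match ofLex z with
    | .inl a => ⟨Sum.inlₗ a.1, Sum.Lex.inl_le_inl_iff.2 a.2⟩
    | .inr b => ⟨Sum.inrₗ b, Sum.Lex.inl_le_inr _ _⟩
  have hf : StrictMono f := by
    rintro (a | b) (a' | b') h
    · exact Sum.Lex.inl_lt_inl_iff.2 (Subtype.coe_lt_coe.2 (Sum.Lex.inl_lt_inl_iff.1 h))
    · exact Sum.Lex.inl_lt_inr _ _
    · exact absurd h Sum.Lex.not_inr_lt_inl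
    · exact Sum.Lex.inr_lt_inr_iff.2 (Sum.Lex.inr_lt_inr_iff.1 h)
  have hs : Function.Surjective f := by
    rintro ⟨a | b, h⟩
    · exact ⟨Sum.inlₗ ⟨a, Sum.Lex.inl_le_inl_iff.1 h⟩, rfl⟩
    · exact ⟨Sum.inrₗ b, rfl⟩
  exact ⟨(hf.orderIsoOfSurjective f hs).symm⟩

theorem nonempty_Ici_inrₗ_orderIso (y : β) :
    Nonempty (Set.Ici (Sum.inrₗ y : α ⊕ₗ β) ≃o Set.Ici y) := by
  let f : Set.Ici y → Set.Ici (Sum.inrₗ y : α ⊕ₗ β) :=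
    fun b => ⟨Sum.inrₗ b.1, Sum.Lex.inr_le_inr_iff.2 b.2⟩
  have hf : StrictMono f := fun _ _ h => Sum.Lex.inr_lt_inr_iff.2 h
  have hs : Function.Surjective f := by
    rintro ⟨a | b, h⟩
    · exact absurd h Sum.Lex.not_inr_le_inl
    · exact ⟨⟨b, Sum.Lex.inr_le_inr_iff.1 h⟩, rfl⟩
  exact ⟨(hf.orderIsoOfSurjective f hs).symm⟩

/-- If the points above `k` form a copy `g` of `ℕ`, then the tail of the lexicographic product at
a point `(k, x)` is the tail of its copy of `β`, followed by `ℕ` many copies of `β`. -/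
theorem nonempty_Ici_toLex_orderIso {k : α} {x : β} (g : ℕ → α) (hg : StrictMono g)
    (hgk : ∀ a, k < a ↔ a ∈ Set.range g) :
    Nonempty (Set.Ici (toLex (k, x) : α ×ₗ β) ≃o Set.Ici x ⊕ₗ (ℕ ×ₗ β)) := by
  let f : Set.Ici x ⊕ₗ (ℕ ×ₗ β) → Set.Ici (toLex (k, x) : α ×ₗ β) := fun z =>
    match ofLex z with
    | .inl b => ⟨toLex (k, b.1), Prod.Lex.toLex_le_toLex.2 (.inr ⟨rfl, b.2⟩)⟩
    | .inr c => ⟨toLex (g (ofLex c).1, (ofLex c).2),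
        Prod.Lex.toLex_le_toLex.2 (.inl ((hgk _).2 ⟨_, rfl⟩))⟩
  have hf : StrictMono f := by
    rintro (a | b) (a' | b') h
    · exact Prod.Lex.toLex_lt_toLex.2 (.inr ⟨rfl, Subtype.coe_lt_coe.2 (Sum.Lex.inl_lt_inl_iff.1 h)⟩)
    · exact Prod.Lex.toLex_lt_toLex.2 (.inl ((hgk _).2 ⟨_, rfl⟩))
    · exact absurd h Sum.Lex.not_inr_lt_inl
    · refine Prod.Lex.toLex_lt_toLex.2 ?_
      rcases Prod.Lex.lt_iff.1 (Sum.Lex.inr_lt_inr_iff.1 h) with h | h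
      · exact .inl (hg h)
      · exact .inr ⟨congrArg g h.1, h.2⟩
  have hs : Function.Surjective f := by
    rintro ⟨⟨a, b⟩, h⟩
    rcases Prod.Lex.le_iff.1 (Set.mem_Ici.1 h) with h | ⟨h, h'⟩
    · obtain ⟨m, rfl⟩ := (hgk a).1 h
      exact ⟨Sum.inrₗ (toLex (m, b)), rfl⟩
    · obtain rfl : k = a := h
      exact ⟨Sum.inlₗ ⟨b, h'⟩, rfl⟩
  exact ⟨(hf.orderIsoOfSurjective f hs).symm⟩

theorem nonempty_Ici_nat_prod_orderIso (x : ℕ ×ₗ β) :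
    Nonempty (Set.Ici x ≃o Set.Ici (ofLex x).2 ⊕ₗ (ℕ ×ₗ β)) :=
  nonempty_Ici_toLex_orderIso (k := (ofLex x).1) (fun m => (ofLex x).1 + 1 + m)
    (fun _ _ h => Nat.add_lt_add_left h _)
    (fun a => ⟨fun h => ⟨a - ((ofLex x).1 + 1), by dsimp only; omega⟩,
      by rintro ⟨m, rfl⟩; dsimp only; omega⟩)

theorem nonempty_Ici_int_prod_orderIso (x : ℤ ×ₗ β) :
    Nonempty (Set.Ici x ≃o Set.Ici (ofLex x).2 ⊕ₗ (ℕ ×ₗ β)) :=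
  nonempty_Ici_toLex_orderIso (k := (ofLex x).1) (fun m => (ofLex x).1 + 1 + m)
    (fun _ _ h => by dsimp only; omega)
    (fun a => ⟨fun h => ⟨(a - ((ofLex x).1 + 1)).toNat, by dsimp only; omega⟩,
      by rintro ⟨m, rfl⟩; dsimp only; omega⟩)

end Tails

/-! ### Strings -/

section Strings

variable {n : ℕ} (s : Fin (n + 2) → ℕ)

@[simp]
theorem minus_tailString : minus (tailString s) = minus s := by
  simp [minus, tailString]

theorem plus_tailString : plus (tailString s) = tailString (minus s) := by
  simp [minus, plus, tailString]

@[simp]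
theorem tailString_plus : tailString (plus s) = tailString (minus s) := by
  simp [minus, plus, tailString]

@[simp]
theorem tailString_last : tailString s (Fin.last (n + 1)) = 0 := by
  simp [tailString]

end Strings

/-! ### Leaves and their weights -/

theorem length_leaves (n : ℕ) (t : Fin (n + 1) → ℕ) (k : ℕ) : (leaves n t k).length = lf t := by
  unfold lf
  induction n generalizing k with
  | zero => rfl
  | succ n ih =>
    rw [leaves, leaves]
    split_ifs
    · rw [List.length_append, List.length_append, ih (plus t) (k + 1), ih (plus t) (0 + 1)]
    · rfl

theorem lf_succ_of_lt {n : ℕ} {t : Fin (n + 2) → ℕ} (h : t (Fin.last (n + 1)) < n + 1) :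
    lf t = lf (plus t) + lf (minus t) := by
  rw [lf, leaves, if_pos h, List.length_append, length_leaves, length_leaves]

theorem lf_succ_of_not_lt {n : ℕ} {t : Fin (n + 2) → ℕ} (h : ¬ t (Fin.last (n + 1)) < n + 1) :
    lf t = lf (minus t) := by
  rw [lf, leaves, if_neg h, length_leaves]

theorem lf_tailString {n : ℕ} (s : Fin (n + 2) → ℕ) :
    lf (tailString s) = lf (tailString (minus s)) + lf (minus s) := by
  rw [lf_succ_of_lt (by simp), plus_tailString, minus_tailString]

theorem lf_pos : {n : ℕ} → (t : Fin (n + 1) → ℕ) → 0 < lf t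
  | 0, _ => Nat.one_pos
  | n + 1, t => by
    by_cases h : t (Fin.last (n + 1)) < n + 1
    · rw [lf_succ_of_lt h]
      exact Nat.add_pos_left (lf_pos _) _
    · rw [lf_succ_of_not_lt h]
      exact lf_pos _

/-- The weight of the `i`-th leaf of the tree that grows from the node `⟨t; k⟩`, with the junk
value `0` if there is no such leaf. -/
def leafWt (n : ℕ) (t : Fin (n + 1) → ℕ) (k i : ℕ) : ℕ :=
  ((leaves n t k).map Prod.snd).getD i 0

theorem wt_eq_leafWt {n : ℕ} (s : Fin (n + 1) → ℕ) (i : Fin (lf s)) :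
    wt s i = leafWt n s 0 i := by
  have hi : (i : ℕ) < (leaves n s 0).length := i.2
  simp only [leafWt, List.getD_eq_getElem?_getD, List.getElem?_map, List.getElem?_eq_getElem hi]
  rfl

section LeafWt

variable {n : ℕ} {t : Fin (n + 2) → ℕ} (k : ℕ) {i : ℕ}

theorem leafWt_left (h : t (Fin.last (n + 1)) < n + 1) (hi : i < lf (plus t)) :
    leafWt (n + 1) t k i = leafWt n (plus t) (k + 1) i := by
  rw [leafWt, leaves, if_pos h, List.map_append, List.getD_append _ _ _ _ (by
    rwa [List.length_map, length_leaves])]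
  rfl

theorem leafWt_right (h : t (Fin.last (n + 1)) < n + 1) (hi : lf (plus t) ≤ i) :
    leafWt (n + 1) t k i = leafWt n (minus t) 0 (i - lf (plus t)) := by
  rw [leafWt, leaves, if_pos h, List.map_append, List.getD_append_right _ _ _ _ (by
    rwa [List.length_map, length_leaves]), List.length_map, length_leaves]
  rfl

theorem leafWt_of_not_lt (h : ¬ t (Fin.last (n + 1)) < n + 1) :
    leafWt (n + 1) t k i = leafWt n (minus t) 0 i := by
  rw [leafWt, leaves, if_neg h]
  rfl

end LeafWt

theorem leafWt_le (n : ℕ) (t : Fin (n + 1) → ℕ) (k i : ℕ) : leafWt n t k i ≤ n + k := by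
  induction n generalizing k i with
  | zero => cases i <;> simp [leafWt, leaves]
  | succ n ih =>
    by_cases h : t (Fin.last (n + 1)) < n + 1
    · rcases lt_or_ge i (lf (plus t)) with hi | hi
      · rw [leafWt_left k h hi]
        exact (ih _ _ _).trans (by omega)
      · rw [leafWt_right k h hi]
        exact (ih _ _ _).trans (by omega)
    · rw [leafWt_of_not_lt k h]
      exact (ih _ _ _).trans (by omega)

/-- Every leaf but the leftmost one grows from a right extension on a lower level, hence has a
small weight. -/
theorem leafWt_lt {n : ℕ} {t : Fin (n + 1) → ℕ} {i : ℕ} (k : ℕ) (hi : 0 < i) (hit : i < lf t) :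
    leafWt n t k i < n := by
  induction n generalizing k i with
  | zero => exact absurd (show i < 1 from hit) (by omega)
  | succ n ih =>
    by_cases h : t (Fin.last (n + 1)) < n + 1
    · rcases lt_or_ge i (lf (plus t)) with hi' | hi'
      · rw [leafWt_left k h hi']
        exact (ih _ hi hi').trans n.lt_succ_self
      · rw [leafWt_right k h hi']
        exact Nat.lt_succ_of_le (leafWt_le n _ 0 _)
    · rw [leafWt_of_not_lt k h]
      exact Nat.lt_succ_of_le (leafWt_le n _ 0 _)

/-- The weight `k` of the root `⟨t; k⟩` reaches a leaf only along `n` left extensions, and then the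
weight of this leaf is `n + k`.  Hence smaller weights do not depend on `k`. -/
theorem leafWt_eq_of_lt {n : ℕ} {t : Fin (n + 1) → ℕ} {k i : ℕ} (h : leafWt n t k i < n) (l : ℕ) :
    leafWt n t l i = leafWt n t k i := by
  have key : leafWt n t k i < n + k → leafWt n t l i = leafWt n t k i := by
    clear h
    induction n generalizing k l with
    | zero =>
      cases i <;> simp [leafWt, leaves]
    | succ n ih =>
      by_cases h : t (Fin.last (n + 1)) < n + 1
      · rcases lt_or_ge i (lf (plus t)) with hi | hi
        · rw [leafWt_left k h hi, leafWt_left l h hi]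
          exact fun h' => ih (l + 1) (by omega)
        · rw [leafWt_right k h hi, leafWt_right l h hi]
          exact fun _ => rfl
      · rw [leafWt_of_not_lt k h, leafWt_of_not_lt l h]
        exact fun _ => rfl
  exact key (by omega)

/-- Leaves with equal weights keep equal weights when the weight of the root changes. -/
theorem leafWt_congr {n : ℕ} {t : Fin (n + 1) → ℕ} {k i j : ℕ} (hi : i < lf t) (hj : j < lf t)
    (h : leafWt n t k i = leafWt n t k j) (l : ℕ) : leafWt n t l i = leafWt n t l j := by
  by_cases hlt : leafWt n t k i < n
  · exact (leafWt_eq_of_lt hlt l).trans (h.trans (leafWt_eq_of_lt (h ▸ hlt) l).symm)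
  · -- Both leaves have the weight of the leftmost leaf, so both are leftmost.
    have hi0 : i = 0 := by
      by_contra h0
      exact hlt (leafWt_lt k (Nat.pos_of_ne_zero h0) hi)
    have hj0 : j = 0 := by
      by_contra h0
      exact hlt (h ▸ leafWt_lt k (Nat.pos_of_ne_zero h0) hj)
    rw [hi0, hj0]

/-! ### The chain constructor and the tail array -/

section Chain

variable {n : ℕ} {s : Fin (n + 2) → ℕ} {M : ℕ → LinOrd.{u}}

theorem chain_succ_of_lt (h : s (Fin.last (n + 1)) < n + 1) (M : ℕ → LinOrd.{u}) :
    chain (n + 1) s M = LinOrd.of (chain n (plus s) M ⊕ₗ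
      (ℕ ×ₗ chain n (minus s) (fun i => M (lf (plus s) + i)))) := by
  rw [chain, if_pos h]

theorem chain_succ_of_not_lt (h : ¬ s (Fin.last (n + 1)) < n + 1) (M : ℕ → LinOrd.{u}) :
    chain (n + 1) s M = LinOrd.of (ℤ ×ₗ chain n (minus s) M) := by
  rw [chain, if_neg h]

theorem tailArray_succ_of_lt (h : s (Fin.last (n + 1)) < n + 1) (p : M 0) :
    tailArray (n + 1) s M p = concat (lf (tailString (minus s))) (tailArray n (plus s) M p)
      (fun i => M (lf (plus s) + i)) := by
  rw [tailArray, if_pos h, tailString_plus]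

theorem tailArray_succ_of_not_lt (h : ¬ s (Fin.last (n + 1)) < n + 1) (p : M 0) :
    tailArray (n + 1) s M p =
      concat (lf (tailString (minus s))) (tailArray n (minus s) M p) M := by
  rw [tailArray, if_neg h]

end Chain

theorem concat_of_lt {l i : ℕ} (M N : ℕ → LinOrd.{u}) (h : i < l) : concat l M N i = M i :=
  if_pos h

theorem concat_of_le {l i : ℕ} (M N : ℕ → LinOrd.{u}) (h : l ≤ i) : concat l M N i = N (i - l) :=
  if_neg h.not_gt

theorem concat_add (l : ℕ) (M N : ℕ → LinOrd.{u}) : (fun i => concat l M N (l + i)) = N := by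
  funext i
  rw [concat_of_le _ _ (Nat.le_add_right l i), Nat.add_sub_cancel_left]

/-- `A(s)[M]` depends, up to isomorphism, only on the isomorphism types of the first `lf s` entries
of the array `M`. -/
theorem nonempty_chain_orderIso {n : ℕ} (s : Fin (n + 1) → ℕ) {M N : ℕ → LinOrd.{u}}
    (h : ∀ i < lf s, Nonempty (M i ≃o N i)) : Nonempty (chain n s M ≃o chain n s N) := by
  induction n generalizing M N with
  | zero => exact h 0 (lf_pos s)
  | succ n ih =>
    by_cases hs : s (Fin.last (n + 1)) < n + 1
    · rw [chain_succ_of_lt hs, chain_succ_of_lt hs]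
      rw [lf_succ_of_lt hs] at h
      obtain ⟨e⟩ := ih (plus s) fun i hi => h i (Nat.lt_add_right _ hi)
      obtain ⟨e'⟩ := ih (minus s) fun i hi => h (lf (plus s) + i) (Nat.add_lt_add_left hi _)
      exact ⟨OrderIso.sumLexCongr e (Prod.Lex.prodLexCongr (.refl ℕ) e')⟩
    · rw [chain_succ_of_not_lt hs, chain_succ_of_not_lt hs]
      rw [lf_succ_of_not_lt hs] at h
      obtain ⟨e⟩ := ih (minus s) h
      exact ⟨Prod.Lex.prodLexCongr (.refl ℤ) e⟩

theorem chain_tailString {n : ℕ} (s : Fin (n + 2) → ℕ) (M N : ℕ → LinOrd.{u}) :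
    chain (n + 1) (tailString s) (concat (lf (tailString (minus s))) M N) =
      LinOrd.of (chain n (tailString (minus s)) (concat (lf (tailString (minus s))) M N) ⊕ₗ
        (ℕ ×ₗ chain n (minus s) N)) := by
  rw [chain_succ_of_lt (by simp), plus_tailString, minus_tailString, concat_add]

/-- A chain that is isomorphic to `A(f(s⁻))[M] + A(s⁻)[N] · ℕ` is isomorphic to `A(fs)[M ⌢ N]`. -/
theorem nonempty_orderIso_chain_tailString {n : ℕ} (s : Fin (n + 2) → ℕ) (M N : ℕ → LinOrd.{u})
    {α β : Type*} [LinearOrder α] [LinearOrder β]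
    (hα : Nonempty (α ≃o β ⊕ₗ (ℕ ×ₗ chain n (minus s) N)))
    (hβ : Nonempty (β ≃o chain n (tailString (minus s)) M)) :
    Nonempty (α ≃o
      chain (n + 1) (tailString s) (concat (lf (tailString (minus s))) M N)) := by
  obtain ⟨e⟩ := hα
  obtain ⟨e₁⟩ := hβ
  obtain ⟨e₂⟩ := nonempty_chain_orderIso (tailString (minus s)) (M := M)
    (N := concat (lf (tailString (minus s))) M N)
    fun i hi => ⟨by rw [concat_of_lt _ _ hi]⟩
  rw [chain_tailString]
  exact ⟨e.trans (OrderIso.sumLexCongr (e₁.trans e₂) (.refl _))⟩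

theorem tailArray_zero {n : ℕ} (s : Fin (n + 1) → ℕ) (M : ℕ → LinOrd.{u}) (p : M 0) :
    tailArray n s M p 0 = LinOrd.of (Set.Ici p) := by
  induction n with
  | zero => rfl
  | succ n ih =>
    by_cases hs : s (Fin.last (n + 1)) < n + 1
    · rw [tailArray_succ_of_lt hs, concat_of_lt _ _ (lf_pos _), ih]
    · rw [tailArray_succ_of_not_lt hs, concat_of_lt _ _ (lf_pos _), ih]

/-- The entries of the tail array `f_s(M)`, other than the `0`-th one, are entries of `M`, and their
weights in the tree of `fs` and in the tree of `s` agree. -/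
theorem exists_tailArray_eq {n : ℕ} (s : Fin (n + 1) → ℕ) (M : ℕ → LinOrd.{u}) (p : M 0) {i : ℕ}
    (hi : 0 < i) (hil : i < lf (tailString s)) :
    ∃ j < lf s, tailArray n s M p i = M j ∧ leafWt n (tailString s) 0 i = leafWt n s 0 j := by
  induction n generalizing M i with
  | zero => exact absurd (show i < 1 from hil) (by omega)
  | succ n ih =>
    have hfs : tailString s (Fin.last (n + 1)) < n + 1 := by simp
    rw [lf_tailString] at hil
    -- The weights of the leaves of the left subtree of `fs` do not depend on its root weight.
    have hleft (hi' : i < lf (tailString (minus s))) : leafWt (n + 1) (tailString s) 0 i =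
        leafWt n (tailString (minus s)) 0 i := by
      rw [leafWt_left 0 hfs (by rwa [plus_tailString]), plus_tailString]
      exact leafWt_eq_of_lt (leafWt_lt 0 hi hi') _
    have hright (hi' : lf (tailString (minus s)) ≤ i) : leafWt (n + 1) (tailString s) 0 i =
        leafWt n (minus s) 0 (i - lf (tailString (minus s))) := by
      rw [leafWt_right 0 hfs (by rwa [plus_tailString]), plus_tailString, minus_tailString]
    by_cases hs : s (Fin.last (n + 1)) < n + 1
    · rw [tailArray_succ_of_lt hs, lf_succ_of_lt hs]
      rcases lt_or_ge i (lf (tailString (minus s))) with hi' | hi'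
      · obtain ⟨j, hj, hMj, hwt⟩ := ih (plus s) M p hi (by rwa [tailString_plus])
        rw [tailString_plus] at hwt
        refine ⟨j, Nat.lt_add_right _ hj, by rw [concat_of_lt _ _ hi', hMj], ?_⟩
        rw [hleft hi', leafWt_left 0 hs hj, hwt]
        exact (leafWt_eq_of_lt (hwt ▸ leafWt_lt 0 hi hi') _).symm
      · refine ⟨lf (plus s) + (i - lf (tailString (minus s))), by omega,
          by rw [concat_of_le _ _ hi'], ?_⟩
        rw [hright hi', leafWt_right 0 hs (Nat.le_add_right _ _), Nat.add_sub_cancel_left]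
    · rw [tailArray_succ_of_not_lt hs, lf_succ_of_not_lt hs]
      rcases lt_or_ge i (lf (tailString (minus s))) with hi' | hi'
      · obtain ⟨j, hj, hMj, hwt⟩ := ih (minus s) M p hi hi'
        exact ⟨j, hj, by rw [concat_of_lt _ _ hi', hMj],
          by rw [hleft hi', leafWt_of_not_lt 0 hs, hwt]⟩
      · exact ⟨i - lf (tailString (minus s)), by omega, by rw [concat_of_le _ _ hi'],
          by rw [hright hi', leafWt_of_not_lt 0 hs]⟩

/-! ### Tails of `A(s)[M]` -/

theorem HasRank.nonempty {A : LinOrd.{u}} {α : Ordinal.{v}} (h : HasRank A α) (hα : α ≠ 0) :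
    Nonempty A := by
  by_contra hA
  exact hα (nonpos_iff_eq_zero.1 (h.2 fun x => absurd ⟨x⟩ hA))

/-- The tail of `A(s)[M]` at any point is `A(fs)[f_s(M)]`.  The entries of `M` have to be nonempty so
that the tail array of the second part of `M` can be formed when `s⁺` is a string. -/
theorem nonempty_Ici_orderIso_chain_tailString {n : ℕ} (s : Fin (n + 1) → ℕ) (M : ℕ → LinOrd.{u})
    (hM : ∀ i < lf s, Nonempty (M i))
    (ha : ∀ i < lf s, ∀ j < lf s, SameTail (M i) (M j))
    (hb : ∀ i < lf s, ∀ j < lf s, leafWt n s 0 i = leafWt n s 0 j → Nonempty (M i ≃o M j))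
    (x : chain n s M) (p : M 0) :
    Nonempty (Set.Ici x ≃o chain n (tailString s) (tailArray n s M p)) := by
  induction n generalizing M with
  | zero => exact ha 0 (lf_pos s) 0 (lf_pos s) x p
  | succ n ih =>
    by_cases hs : s (Fin.last (n + 1)) < n + 1
    · rw [lf_succ_of_lt hs] at hM ha hb
      set l := lf (plus s) with hl
      have hl₁ {i : ℕ} (hi : i < l) : i < l + lf (minus s) := Nat.lt_add_right _ hi
      have hl₂ {i : ℕ} (hi : i < lf (minus s)) : l + i < l + lf (minus s) :=
        Nat.add_lt_add_left hi _
      have ih₁ := ih (plus s) M (fun i hi => hM i (hl₁ hi))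
        (fun i hi j hj => ha i (hl₁ hi) j (hl₁ hj))
        (fun i hi j hj hij => hb i (hl₁ hi) j (hl₁ hj) (by
          rw [leafWt_left 0 hs hi, leafWt_left 0 hs hj]
          exact leafWt_congr hi hj hij _))
      have ih₂ := ih (minus s) (fun i => M (l + i)) (fun i hi => hM _ (hl₂ hi))
        (fun i hi j hj => ha _ (hl₂ hi) _ (hl₂ hj))
        (fun i hi j hj hij => hb _ (hl₂ hi) _ (hl₂ hj) (by
          rwa [leafWt_right 0 hs (Nat.le_add_right _ _), leafWt_right 0 hs (Nat.le_add_right _ _),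
            Nat.add_sub_cancel_left, Nat.add_sub_cancel_left]))
      rw [tailString_plus] at ih₁
      obtain ⟨q⟩ : Nonempty (M (l + 0)) := hM _ (hl₂ (lf_pos _))
      -- The tail arrays of the two parts of `M` are entrywise isomorphic.
      have harr (i : ℕ) (hi : i < lf (tailString (minus s))) :
          Nonempty (tailArray n (minus s) (fun i => M (l + i)) q i ≃o
            tailArray n (plus s) M p i) := by
        rcases Nat.eq_zero_or_pos i with rfl | hi0
        · rw [tailArray_zero, tailArray_zero]
          exact ha _ (hl₂ (lf_pos _)) 0 (hl₁ (lf_pos _)) q p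
        · obtain ⟨j, hj, hMj, hwj⟩ := exists_tailArray_eq (minus s) (fun i => M (l + i)) q hi0 hi
          obtain ⟨j', hj', hMj', hwj'⟩ := exists_tailArray_eq (plus s) M p hi0
            (by rwa [tailString_plus])
          rw [tailString_plus] at hwj'
          rw [hMj, hMj']
          refine hb _ (hl₂ hj) _ (hl₁ hj') ?_
          rw [leafWt_right 0 hs (Nat.le_add_right _ _), Nat.add_sub_cancel_left, ← hwj,
            leafWt_left 0 hs hj', hwj']
          exact (leafWt_eq_of_lt (hwj' ▸ leafWt_lt 0 hi0 hi) _).symm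
      obtain ⟨e⟩ := nonempty_chain_orderIso _ harr
      rw [tailArray_succ_of_lt hs]
      revert x
      rw [chain_succ_of_lt hs]
      rintro (x | x)
      · exact nonempty_orderIso_chain_tailString s _ _ (nonempty_Ici_inlₗ_orderIso x) (ih₁ x p)
      · obtain ⟨e₁⟩ := nonempty_Ici_inrₗ_orderIso (α := chain n (plus s) M) x
        obtain ⟨e₂⟩ := nonempty_Ici_nat_prod_orderIso x
        obtain ⟨e₃⟩ := ih₂ (ofLex x).2 q
        exact nonempty_orderIso_chain_tailString s _ _ ⟨e₁.trans e₂⟩ ⟨e₃.trans e⟩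
    · rw [lf_succ_of_not_lt hs] at hM ha hb
      simp only [leafWt_of_not_lt 0 hs] at hb
      rw [tailArray_succ_of_not_lt hs]
      revert x
      rw [chain_succ_of_not_lt hs]
      intro x
      exact nonempty_orderIso_chain_tailString s _ _ (nonempty_Ici_int_prod_orderIso x)
        (ih (minus s) M hM ha hb (ofLex x).2 p)

end UniformChain

theorem lemma3p14 {n : ℕ} (s : Fin (n + 1) → ℕ) (hs : UniformChain.IsString s)
    (M : ℕ → LinOrd.{u})
    (hM : ∀ i < UniformChain.lf s, UniformChain.UCOmega (M i))
    (ha : ∀ i < UniformChain.lf s, ∀ j < UniformChain.lf s, UniformChain.SameTail (M i) (M j))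
    (hb : ∀ i j : Fin (UniformChain.lf s), UniformChain.wt s i = UniformChain.wt s j →
      Nonempty (M i ≃o M j)) :
    UniformChain.Uniform (UniformChain.chain n s M) ∧
    ∀ (x : UniformChain.chain n s M) (p : M 0),
      Nonempty (Set.Ici x ≃o
        UniformChain.chain n (UniformChain.tailString s) (UniformChain.tailArray n s M p)) := by
  have hne (i : ℕ) (hi : i < lf s) : Nonempty (M i) :=
    (hM i hi).2.nonempty Ordinal.omega0_ne_zero
  have key := nonempty_Ici_orderIso_chain_tailString s M hne ha fun i hi j hj h =>
    hb ⟨i, hi⟩ ⟨j, hj⟩ (by rw [wt_eq_leafWt, wt_eq_leafWt]; exact h)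
  obtain ⟨p⟩ := hne 0 (lf_pos s)
  refine ⟨fun x y => ?_, key⟩
  obtain ⟨e⟩ := key x p
  obtain ⟨e'⟩ := key y p
  exact ⟨e.trans e'.symm⟩
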